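/- Let $f:\mathbb R^n\to\mathbb R$ and $g=(g_1,\dots,g_m):\mathbb R^n\to\mathbb R^m$ be continuously differentiable with locally Lipschitz gradients, and consider the problem (P) of minimizing $f(x)$ subject to $g(x)\le 0$. Write $\|\cdot\|$ for the Euclidean norm, $\alpha_+=\max\{0,\alpha\}$, $e=(1,\dots,1)^T\in\mathbb R^m$, $\nabla g(x)$ for the transposed Jacobian, $\max_i\{y_i\}_+:=\max_i\,(y_i)_+$ (equal to $0$ if $m=0$), and $N_{\mathbb R^m_-}(y)$ for the normal cone of convex analysis to $\mathbb R^m_-$ at $y$ (empty if $y\notin\mathbb R^m_-$). Put $$M_1(x)=\{\xi: \xi\in N_{\mathbb R^m_-}(g(x)),\ 0=\nabla f(x)+\nabla g(x)\xi\},$$ $$M_0(x)=\{\xi: \xi\in N_{\mathbb R^m_-}(g(x)-\max_i\{g_i(x)\}_+\,e),\ 0=\nabla g(x)\xi\}.$$ A point $x$ is a KKT point if $g(x)\le0$ and $M_1(x)\ne\emptyset$; a Fritz-John point if $g(x)\le 0$ and $M_0(x)\neq\{0\}$; an external stationary point if $g_i(x)>0$ for some $i$ and $M_0(x)\ne\{0\}$;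 it is stationary if it is any of these. The eMFCQ holds at $x$ if $M_0(x)=\{0\}$. Fix $0<\rho<\beta$ and $\lambda\in(0,1)$. Let $O$ be an open (convex) neighbourhood of $\{d\in\mathbb R^n:\|d\|_\infty\le\beta\}$ and let $\tilde f,\tilde g_1,\dots,\tilde g_m:O\times\mathbb R^n\to\mathbb R$ be continuously differentiable in the first argument and satisfy Assumption A: for every $x$, $\tilde f(\cdot;x)$ is strongly convex on $O$ with a modulus $c>0$ independent of $x$, and each $\tilde g_i(\cdot;x)$ is convex on $O$; the functions $\tilde f$, $\tilde g_i$ and their partial gradients $\nabla_1\tilde f$, $\nabla_1\tilde g_i$ in the first argument are continuous on $O\times\mathbb R^n$; and for every $x$ and $i$, $\nabla_1\tilde f(0;x)=\nabla f(x)$, $\tilde g_i(0;x)=g_i(x)$ and $\nabla_1\tilde g_i(0;x)=\nabla g_i(x)$. Let $$\kappa(x)=(1-\lambda)\max_i\{g_i(x)\}_++\lambda\min_{\|d\|_\infty\le\rho}\max_i\{\tilde g_i(d;x)\}_+ ,$$ and let $d(x)$ be the (unique) minimizer of $\tilde f(\cdot;x)$ over $\{d: \tilde g(d;x)\le\kappa(x)e,\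 \|d\|_\infty\le\beta\}$. Let $\gamma^\nu>0$ with $\gamma^\nu\to0$ and $\sum_{\nu\ge0}\gamma^\nu=\infty$, and let $\{x^\nu\}$ be generated from an arbitrary $x^0$ by the algorithm that stops at $x^\nu$ if $x^\nu$ is stationary for (P) (in which case the sequence is continued by repeating $x^\nu$), and otherwise sets $x^{\nu+1}=x^\nu+\gamma^\nu d(x^\nu)$. Then either the sequence $\{x^\nu\}$ is unbounded or the following two assertions hold: (i) at least one limit point $\hat x$ of $\{x^\nu\}$ is stationary for (P); in particular, if the eMFCQ holds at $\hat x$, then $\hat x$ is a KKT point of (P); (ii) if, in addition, the eMFCQ holds at every limit point of $\{x^\nu\}$ and $d(\cdot)$ is Hölder continuous on compact sets (Assumption B: for every compact $K\subset\mathbb R^n$ there are $\theta,\alpha>0$ with $\|d(y)-d(z)\|\le\theta\|y-z\|^\alpha$ for all $y,z\in K$), then every limit point of $\{x^\nu\}$ is a KKT point of (P). -/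

import Mathlib

open Set Filter Topology

noncomputable section

namespace GhostPenalty

/-- Euclidean space `ℝⁿ` (norm `‖·‖` and gradients are Euclidean). -/
abbrev E (n : ℕ) := EuclideanSpace ℝ (Fin n)

/-- `LC¹`: continuously differentiable with locally Lipschitz gradient. -/
def IsLC1 {n : ℕ} (f : E n → ℝ) : Prop :=
  ContDiff ℝ 1 f ∧ LocallyLipschitz (gradient f)

/-- `max_i (y_i)_+`; it is `0` when there are no components. -/
def maxPos {m : ℕ} (y : Fin m → ℝ) : ℝ := ⨆ i, max (y i) 0

/-- The closed ball of radius `r` for the infinity norm, centred at the origin of `ℝⁿ`. -/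
def box (n : ℕ) (r : ℝ) : Set (E n) := {d | ∀ j, |d j| ≤ r}

/-- The normal cone to a convex set `C ⊆ ℝᵐ` at `y`; it is empty when `y ∉ C`. -/
def normalCone {m : ℕ} (C : Set (Fin m → ℝ)) (y : Fin m → ℝ) : Set (Fin m → ℝ) :=
  {ξ | y ∈ C ∧ ∀ z ∈ C, ξ ⬝ᵥ (z - y) ≤ 0}

/-- The transposed Jacobian of `g` at `x` applied to `ξ`: `∇g(x) ξ = ∑ i, ξ_i ∇g_i(x)`. -/
def gradMul {n m : ℕ} (g : E n → Fin m → ℝ) (x : E n) (ξ : Fin m → ℝ) : E n :=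
  ∑ i, ξ i • gradient (fun y => g y i) x

/-- The set `M₁(x)` of KKT multipliers; `Set.Iic 0` is the nonpositive orthant of `ℝᵐ`. -/
def M1 {n m : ℕ} (f : E n → ℝ) (g : E n → Fin m → ℝ) (x : E n) : Set (Fin m → ℝ) :=
  {ξ | ξ ∈ normalCone (Set.Iic 0) (g x) ∧ 0 = gradient f x + gradMul g x ξ}

/-- The set `M₀(x)` of abnormal multipliers. -/
def M0 {n m : ℕ} (g : E n → Fin m → ℝ) (x : E n) : Set (Fin m → ℝ) :=
  {ξ | ξ ∈ normalCone (Set.Iic 0) (fun i => g x i - maxPos (g x)) ∧ 0 = gradMul g x ξ}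

/-- KKT point of `min f` subject to `g ≤ 0`. -/
def IsKKT {n m : ℕ} (f : E n → ℝ) (g : E n → Fin m → ℝ) (x : E n) : Prop :=
  g x ≤ 0 ∧ (M1 f g x).Nonempty

/-- Fritz-John point. -/
def IsFJ {n m : ℕ} (g : E n → Fin m → ℝ) (x : E n) : Prop :=
  g x ≤ 0 ∧ M0 g x ≠ {0}

/-- External stationary point. -/
def IsES {n m : ℕ} (g : E n → Fin m → ℝ) (x : E n) : Prop :=
  (∃ i, 0 < g x i) ∧ M0 g x ≠ {0}

/-- (Generalized) stationary point. -/
def IsStationary {n m : ℕ} (f : E n → ℝ) (g : E n → Fin m → ℝ) (x : E n) : Prop :=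
  IsKKT f g x ∨ IsFJ g x ∨ IsES g x

/-- The extended Mangasarian-Fromovitz constraint qualification at `x`. -/
def EMFCQ {n m : ℕ} (g : E n → Fin m → ℝ) (x : E n) : Prop :=
  M0 g x = {0}

/-- The standing conditions on the surrogates `ft d x` of `f` and `gt d x` of `g`, where `d` is the
direction and `x` the base point. Only the values for `d` in the open neighbourhood `O` of the box
of radius `β` matter. -/
structure SurrogateAssumptions {n m : ℕ} (f : E n → ℝ) (g : E n → Fin m → ℝ)
    (ft : E n → E n → ℝ) (gt : E n → E n → Fin m → ℝ) (β : ℝ) (O : Set (E n)) : Prop where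
  isOpen : IsOpen O
  box_subset : box n β ⊆ O
  contDiff_f : ∀ x, ContDiffOn ℝ 1 (fun d => ft d x) O
  contDiff_g : ∀ i x, ContDiffOn ℝ 1 (fun d => gt d x i) O
  strongConvex_f : ∃ c : ℝ, 0 < c ∧ ∀ x, StrongConvexOn O c (fun d => ft d x)
  continuous_f : ContinuousOn (fun p : E n × E n => ft p.1 p.2) (O ×ˢ Set.univ)
  continuous_grad_f :
    ContinuousOn (fun p : E n × E n => gradient (fun d => ft d p.2) p.1) (O ×ˢ Set.univ)
  grad_f_zero : ∀ x, gradient (fun d => ft d x) 0 = gradient f x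
  convex_g : ∀ i x, ConvexOn ℝ O (fun d => gt d x i)
  continuous_g : ∀ i, ContinuousOn (fun p : E n × E n => gt p.1 p.2 i) (O ×ˢ Set.univ)
  g_zero : ∀ i x, gt 0 x i = g x i
  continuous_grad_g : ∀ i,
    ContinuousOn (fun p : E n × E n => gradient (fun d => gt d p.2 i) p.1) (O ×ˢ Set.univ)
  grad_g_zero : ∀ i x, gradient (fun d => gt d x i) 0 = gradient (fun y => g y i) x

/-- The relaxation level `κ(x)`. The infimum is over a nonempty compact set and is attained when
`gt` is continuous in its first argument. -/
def kappa {n m : ℕ} (g : E n → Fin m → ℝ) (gt : E n → E n → Fin m → ℝ) (ρ lam : ℝ)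
    (x : E n) : ℝ :=
  (1 - lam) * maxPos (g x) + lam * sInf ((fun d => maxPos (gt d x)) '' box n ρ)

/-- The feasible set of the direction-finding subproblem at `x`. -/
def feasibleSet {n m : ℕ} (g : E n → Fin m → ℝ) (gt : E n → E n → Fin m → ℝ) (β ρ lam : ℝ)
    (x : E n) : Set (E n) :=
  {d | (∀ i, gt d x i ≤ kappa g gt ρ lam x) ∧ d ∈ box n β}

/-- `d` solves the direction-finding subproblem at `x`. -/
def IsSubproblemSolution {n m : ℕ} (g : E n → Fin m → ℝ) (ft : E n → E n → ℝ)
    (gt : E n → E n → Fin m → ℝ) (β ρ lam : ℝ) (x d : E n) : Prop :=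
  d ∈ feasibleSet g gt β ρ lam x ∧
    IsMinOn (fun u => ft u x) (feasibleSet g gt β ρ lam x) d

/-- The solution `d(x)` of the direction-finding subproblem at `x`; under `SurrogateAssumptions`
the feasible set is nonempty, compact and convex and the objective strongly convex, so that
the solution exists and is unique. -/
def direction {n m : ℕ} (g : E n → Fin m → ℝ) (ft : E n → E n → ℝ)
    (gt : E n → E n → Fin m → ℝ) (β ρ lam : ℝ) (x : E n) : E n :=
  Classical.epsilon (IsSubproblemSolution g ft gt β ρ lam x)

/-- A run of the algorithm with stepsizes `γ`: it stops at the first stationary iterate (a stopped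
run is continued by repeating the returned point) and otherwise moves along `d(x ν)`. -/
def IsRun {n m : ℕ} (f : E n → ℝ) (g : E n → Fin m → ℝ) (ft : E n → E n → ℝ)
    (gt : E n → E n → Fin m → ℝ) (β ρ lam : ℝ) (γ : ℕ → ℝ) (x : ℕ → E n) : Prop :=
  ∀ ν, (IsStationary f g (x ν) → x (ν + 1) = x ν) ∧
    (¬ IsStationary f g (x ν) →
      x (ν + 1) = x ν + γ ν • direction g ft gt β ρ lam (x ν))

/-- Hölder continuity of a map on compact sets (the exponent may depend on the compact set). -/
def HolderOnCompacts {n : ℕ} (d : E n → E n) : Prop :=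
  ∀ K : Set (E n), IsCompact K → ∃ θ α : ℝ, 0 < θ ∧ 0 < α ∧
    ∀ y ∈ K, ∀ z ∈ K, ‖d y - d z‖ ≤ θ * ‖y - z‖ ^ α

/-- `p` is a limit point of the sequence `x`: some subsequence converges to it. -/
def IsLimitPoint {n : ℕ} (x : ℕ → E n) (p : E n) : Prop :=
  ∃ φ : ℕ → ℕ, StrictMono φ ∧ Tendsto (x ∘ φ) atTop (𝓝 p)

end GhostPenalty

end

/-! The proof follows the penalty function `V = f + D * maxPos g` with one fixed weight `D`, along a
bounded run that never reaches a stationary point (a run that does is eventually constant). Put θ(x)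
= maxPos (g x) - κ(x) ≥ 0. Near a point where the eMFCQ holds the subproblem has a Slater point with
a uniform margin. Comparing d(x) with a convex combination of 0 and that point gives ⟨∇f(x), d(x)⟩ ≤
C θ(x) - (c/2)‖d(x)‖² (`exists_eventually_inner_direction_le`). By compactness, one C serves a whole
tail of the run if the eMFCQ holds at all limit points. A step lowers the infeasibility by γθ up to
a term of order γ²‖d‖² (`maxPos_step_le`), so `V` eventually drops by at least (c/4)γ‖d‖² per step.
Near a limit point that is not KKT, ‖d(x)‖ stays above some δ > 0
(`exists_eventually_le_norm_direction`). There the drop in `V` controls the distance travelled, so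
an iterate close to that point with `V` almost at its infimum traps all later ones nearby. Then ∑γ
would converge, a contradiction (`not_limitPoint_of_descent`). This gives (ii). For (i), if no limit
point were stationary, the eMFCQ would hold at all of them, and (ii) would make them KKT. -/

noncomputable section
namespace GhostPenalty

/-! ### General tools: alternatives, first-order bounds, descent sequences -/

/-- Gordan's theorem of the alternative, for the vectors `a i` with `i ∈ S`. -/
lemma gordan_alternative {ι F : Type*} [Fintype ι] [NormedAddCommGroup F]
    [InnerProductSpace ℝ F] [CompleteSpace F] (S : Set ι) (a : ι → F) :
    (∃ h : F, ∀ i ∈ S, inner ℝ (a i) h < 0) ∨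
      ∃ w : ι → ℝ, (∀ i, 0 ≤ w i) ∧ (∀ i ∉ S, w i = 0) ∧ ∑ i, w i = 1 ∧
        ∑ i, w i • a i = 0 := by
  classical
  -- `T` is the face of the simplex of weights supported on `S`, so `A '' T` is the convex hull of
  -- the `a i` with `i ∈ S`. It either contains 0 or is strictly separated from it.
  let T : Set (ι → ℝ) := stdSimplex ℝ ι ∩ ⋂ i ∈ Sᶜ, {w | w i = 0}
  let A : (ι → ℝ) →ₗ[ℝ] F := ∑ i, (LinearMap.proj i : (ι → ℝ) →ₗ[ℝ] ℝ).smulRight (a i)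
  have hA : ∀ w, A w = ∑ i, w i • a i := fun w => by simp [A]
  have hAc : Continuous A := by
    have : (A : (ι → ℝ) → F) = fun w => ∑ i, w i • a i := funext hA
    rw [this]; fun_prop
  have hTc : IsCompact T := by
    refine (isCompact_stdSimplex ℝ ι).inter_right (isClosed_biInter fun i _ => ?_)
    exact isClosed_eq (continuous_apply i) continuous_const
  have hTconv : Convex ℝ T := by
    refine (convex_stdSimplex ℝ ι).inter (convex_iInter₂ fun i _ => ?_)
    intro u hu v hv s t _ _ _
    simp only [mem_ofPred_eq] at hu hv ⊢
    simp [hu, hv]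
  by_cases h0 : (0 : F) ∈ A '' T
  · right
    obtain ⟨w, ⟨hw1, hw2⟩, hw0⟩ := h0
    refine ⟨w, hw1.1, fun i hi => ?_, hw1.2, by rw [← hA, hw0]⟩
    simpa using mem_iInter₂.1 hw2 i hi
  · left
    obtain ⟨l, u, hl, hu⟩ := geometric_hahn_banach_closed_point
      (hTconv.linear_image A) (hTc.image hAc).isClosed h0
    refine ⟨(InnerProductSpace.toDual ℝ F).symm l, fun i hi => ?_⟩
    rw [real_inner_comm, InnerProductSpace.toDual_symm_apply]
    have hmem : a i ∈ A '' T := by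
      refine ⟨Pi.single i 1, ⟨single_mem_stdSimplex ℝ i, mem_iInter₂.2 fun j hj => ?_⟩, ?_⟩
      · have : j ≠ i := fun h => hj (h ▸ hi)
        simp [this]
      · rw [hA, Finset.sum_eq_single i] <;> simp +contextual
    have := hl _ hmem
    simp only [map_zero] at hu
    linarith

/-- Quadratic upper bound on a compact convex set for functions with locally Lipschitz gradient. -/
lemma IsLC1.exists_quadratic_bound {n : ℕ} {h : E n → ℝ} (hh : IsLC1 h) {K : Set (E n)}
    (hK : IsCompact K) (hKc : Convex ℝ K) :
    ∃ L : ℝ, 0 ≤ L ∧ ∀ y ∈ K, ∀ z ∈ K,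
      h z ≤ h y + inner ℝ (gradient h y) (z - y) + L * ‖z - y‖ ^ 2 := by
  obtain ⟨L, hL⟩ := (hh.2.locallyLipschitzOn (s := K)).exists_lipschitzOnWith_of_compact hK
  refine ⟨L, L.2, fun y hy z hz => ?_⟩
  have hd : ∀ u, HasGradientAt h (gradient h u) u := fun u =>
    ((hh.1.differentiable (by norm_num)) u).hasGradientAt
  have hseg : segment ℝ y z ⊆ K := hKc.segment_subset hy hz
  -- Mean value inequality for `h` minus its linearization at `y`; on the segment the gradient
  -- deviates by at most `L * ‖z - y‖`.
  have key := (convex_segment y z).norm_image_sub_le_of_norm_hasFDerivWithin_le'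
    (f := h) (f' := fun u => InnerProductSpace.toDual ℝ (E n) (gradient h u))
    (φ := InnerProductSpace.toDual ℝ (E n) (gradient h y)) (C := L * ‖z - y‖)
    (x := y) (y := z)
    (fun u _ => (hd u).hasFDerivAt.hasFDerivWithinAt)
    (fun u hu => by
      rw [← map_sub, LinearIsometryEquiv.norm_map]
      refine (hL.norm_sub_le (hseg hu) hy).trans ?_
      gcongr
      exact norm_sub_le_of_mem_segment hu)
    (left_mem_segment ℝ y z) (right_mem_segment ℝ y z)
  rw [InnerProductSpace.toDual_apply_apply, Real.norm_eq_abs] at key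
  have := (abs_le.1 key).2
  nlinarith

/-- First-order lower bound for a strongly convex function. -/
lemma strongConvexOn_gradient_le {n : ℕ} {O : Set (E n)} {c : ℝ} {h : E n → ℝ}
    (hc : StrongConvexOn O c h) {v y : E n} (hv : HasGradientAt h v y) (hy : y ∈ O) {z : E n}
    (hz : z ∈ O) : inner ℝ v (z - y) ≤ h z - h y - c / 2 * ‖z - y‖ ^ 2 := by
  have hd : HasDerivAt (fun t : ℝ => h (y + t • (z - y))) (inner ℝ v (z - y)) 0 := by
    have h1 : HasDerivAt (fun t : ℝ => y + t • (z - y)) (z - y) 0 := by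
      simpa using ((hasDerivAt_id (0 : ℝ)).smul_const (z - y)).const_add y
    have h2 : HasFDerivAt h (InnerProductSpace.toDual ℝ (E n) v) (y + (0 : ℝ) • (z - y)) := by
      simpa using hv.hasFDerivAt
    simpa [Function.comp_def] using h2.comp_hasDerivAt 0 h1
  have hs := hd.tendsto_slope_zero_right
  -- The strong convexity term carries the factor `t * (1 - t)`; dividing by `t` leaves `1 - t`,
  -- which tends to 1.
  have hlim : Tendsto (fun t : ℝ => h z - h y - (1 - t) * (c / 2 * ‖z - y‖ ^ 2)) (𝓝[>] 0)
      (𝓝 (h z - h y - c / 2 * ‖z - y‖ ^ 2)) := by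
    have : Continuous (fun t : ℝ => h z - h y - (1 - t) * (c / 2 * ‖z - y‖ ^ 2)) := by fun_prop
    have := (this.tendsto 0).mono_left (nhdsWithin_le_nhds (s := Ioi 0))
    simpa using this
  refine le_of_tendsto_of_tendsto hs hlim ?_
  filter_upwards [Ioo_mem_nhdsGT (show (0 : ℝ) < 1 by norm_num)] with t ht
  have := hc.2 hy hz (sub_nonneg.2 ht.2.le) ht.1.le (by ring)
  have hpt : (1 - t) • y + t • z = y + t • (z - y) := by
    rw [sub_smul, smul_sub, one_smul]; abel
  rw [hpt, norm_sub_rev y z] at this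
  simp only [zero_add, zero_smul, add_zero, smul_eq_mul] at this ⊢
  rw [inv_mul_le_iff₀ ht.1]
  nlinarith

/-- A differentiable function decreases along a direction of negative slope. -/
lemma eventually_lt_of_inner_neg {n : ℕ} {h : E n → ℝ} {v d : E n} (hv : HasGradientAt h v 0)
    (hd : inner ℝ v d < 0) : ∀ᶠ t : ℝ in 𝓝[>] 0, h (t • d) < h 0 := by
  have hder : HasDerivAt (fun t : ℝ => h (t • d)) (inner ℝ v d) 0 := by
    have h1 : HasDerivAt (fun t : ℝ => t • d) d 0 := by
      simpa using (hasDerivAt_id (0 : ℝ)).smul_const d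
    have h2 : HasFDerivAt h (InnerProductSpace.toDual ℝ (E n) v) ((0 : ℝ) • d) := by
      simpa using hv.hasFDerivAt
    simpa [Function.comp_def] using h2.comp_hasDerivAt 0 h1
  filter_upwards [hder.tendsto_slope_zero_right.eventually_lt_const hd, self_mem_nhdsWithin]
    with t ht ht0
  have ht0 : 0 < t := ht0
  simp only [zero_add, zero_smul, smul_eq_mul] at ht
  have := (inv_mul_lt_iff₀ ht0).1 ht
  linarith

/-- A local property holding near every limit point of a bounded sequence, with a parameter in
which it is monotone, holds along a tail of the sequence with a uniform parameter. -/
lemma exists_eventually_uniform {n : ℕ} {x : ℕ → E n} (hx : Bornology.IsBounded (range x))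
    {Q : ℝ → E n → Prop} (hmono : ∀ a b y, a ≤ b → Q a y → Q b y)
    (hloc : ∀ p, IsLimitPoint x p → ∃ C, ∀ᶠ y in 𝓝 p, Q C y) :
    ∃ C, ∀ᶠ ν in atTop, Q C (x ν) := by
  have hK : IsCompact (closure (range x)) := hx.isCompact_closure
  have : ∃ C, ∀ᶠ ν in atTop, x ν ∈ closure (range x) → Q C (x ν) := by
    refine hK.induction_on (p := fun s => ∃ C, ∀ᶠ ν in atTop, x ν ∈ s → Q C (x ν))
      ⟨0, by simp⟩ ?_ ?_ ?_
    · rintro s t hst ⟨C, hC⟩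
      exact ⟨C, hC.mono fun ν h hν => h (hst hν)⟩
    · rintro s t ⟨C, hC⟩ ⟨D, hD⟩
      refine ⟨max C D, ?_⟩
      filter_upwards [hC, hD] with ν h1 h2 hν
      rcases hν with hν | hν
      · exact hmono _ _ _ (le_max_left _ _) (h1 hν)
      · exact hmono _ _ _ (le_max_right _ _) (h2 hν)
    · intro p _
      by_cases hp : MapClusterPt p atTop x
      · obtain ⟨C, hC⟩ := hloc p hp.tendsto_subseq
        exact ⟨_, mem_nhdsWithin_of_mem_nhds hC, C, Eventually.of_forall fun ν h => h⟩
      -- A point that is not a cluster point has a neighbourhood that the tail avoids, so any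
      -- constant works there.
      · rw [mapClusterPt_iff_frequently] at hp
        push Not at hp
        obtain ⟨s, hs, h⟩ := hp
        refine ⟨s, mem_nhdsWithin_of_mem_nhds hs, 0, h.mono fun ν h1 h2 => absurd h2 h1⟩
  obtain ⟨C, hC⟩ := this
  exact ⟨C, hC.mono fun ν h => h (subset_closure (mem_range_self ν))⟩

/-- Steps of divergent total length cannot stay bounded away from zero near a limit point if they
decrease a function bounded below. -/
lemma not_limitPoint_of_descent {n : ℕ} {x d : ℕ → E n} {γ V : ℕ → ℝ} {a b : ℝ}
    (hγ : ∀ ν, 0 < γ ν)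
    (hγsum : Tendsto (fun N => ∑ ν ∈ Finset.range N, γ ν) atTop atTop)
    (hstep : ∀ ν, x (ν + 1) = x ν + γ ν • d ν) (ha : 0 < a)
    (hV : ∀ᶠ ν in atTop, V (ν + 1) ≤ V ν - a * γ ν * ‖d ν‖ ^ 2) (hb : ∀ ν, b ≤ V ν)
    {p : E n} {δ r : ℝ} (hδ : 0 < δ) (hr : 0 < r)
    (hd : ∀ ν, ‖x ν - p‖ < r → δ ≤ ‖d ν‖) : ¬ IsLimitPoint x p := by
  rintro ⟨φ, hφ, hlim⟩
  obtain ⟨N₀, hN₀⟩ := eventually_atTop.1 hV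
  have hanti : ∀ N, N₀ ≤ N → V (N + 1) ≤ V N := fun N hN => by
    have h1 := hN₀ N hN
    have h2 : 0 ≤ a * γ N * ‖d N‖ ^ 2 := by have := hγ N; positivity
    linarith
  have hantiW : Antitone fun k => V (N₀ + k) :=
    antitone_nat_of_succ_le fun k => hanti (N₀ + k) (by omega)
  have hbdd : BddBelow (range fun k => V (N₀ + k)) := ⟨b, by rintro _ ⟨k, rfl⟩; exact hb _⟩
  have hconv := tendsto_atTop_ciInf hantiW hbdd
  set I := ⨅ k, V (N₀ + k) with hI
  have hIle : ∀ N, N₀ ≤ N → I ≤ V N := fun N hN => by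
    have := ciInf_le hbdd (N - N₀)
    rwa [show N₀ + (N - N₀) = N by omega] at this
  -- Once `V` is within this amount of its infimum, the remaining decrease pays for less than `r /
  -- 2` of travel.
  have hη : 0 < a * δ * (r / 2) := by positivity
  obtain ⟨k₀, hk₀⟩ := eventually_atTop.1 (hconv.eventually_lt_const (lt_add_of_pos_right I hη))
  have hball := hlim.eventually (Metric.ball_mem_nhds p (half_pos hr))
  obtain ⟨j, hj1, hj2⟩ := (hball.and (eventually_ge_atTop (N₀ + k₀))).exists
  set N := φ j with hN
  have hNge : N₀ + k₀ ≤ N := hj2.trans (hφ.id_le j)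
  have hVN : V N < I + a * δ * (r / 2) := by
    have := hk₀ (N - N₀) (by omega)
    rwa [show N₀ + (N - N₀) = N by omega] at this
  have hxN : ‖x N - p‖ < r / 2 := by simpa [dist_eq_norm] using hj1
  -- While the iterates stay in the ball, ‖d‖ ≥ δ gives ‖d‖² ≥ δ‖d‖ and ‖d‖² ≥ δ²: the decrease of
  -- `V` bounds both the displacement and the sum of stepsizes. The first bound keeps the next
  -- iterate in the ball.
  have htrap : ∀ k, a * δ * ‖x (N + k) - x N‖ ≤ V N - V (N + k) ∧
      a * δ ^ 2 * ∑ i ∈ Finset.range k, γ (N + i) ≤ V N - V (N + k) := by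
    intro k
    induction k with
    | zero => simp
    | succ k ih =>
      obtain ⟨ih1, ih2⟩ := ih
      have h1 := hIle (N + k) (by omega)
      have h2 : ‖x (N + k) - x N‖ < r / 2 := by
        have : a * δ * ‖x (N + k) - x N‖ < a * δ * (r / 2) := by linarith
        exact lt_of_mul_lt_mul_left this (by positivity)
      have h3 : ‖x (N + k) - p‖ < r := by
        have := norm_sub_le_norm_sub_add_norm_sub (x (N + k)) (x N) p
        linarith
      have h4 := hd _ h3
      have h5 := hN₀ (N + k) (by omega)
      have hg := hγ (N + k)
      have h6 : ‖x (N + k + 1) - x N‖ ≤ ‖x (N + k) - x N‖ + γ (N + k) * ‖d (N + k)‖ := by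
        rw [hstep, add_sub_right_comm]
        refine (norm_add_le _ _).trans ?_
        rw [norm_smul, Real.norm_of_nonneg hg.le]
      rw [← add_assoc]
      have hag : 0 < a * γ (N + k) := by positivity
      constructor
      · have h7 : a * δ * ‖x (N + k + 1) - x N‖ ≤
            a * δ * ‖x (N + k) - x N‖ + a * γ (N + k) * (δ * ‖d (N + k)‖) := by
          calc _ ≤ a * δ * (‖x (N + k) - x N‖ + γ (N + k) * ‖d (N + k)‖) := by gcongr
            _ = _ := by ring
        have h8 : a * γ (N + k) * (δ * ‖d (N + k)‖) ≤ a * γ (N + k) * ‖d (N + k)‖ ^ 2 := by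
          rw [sq]; gcongr
        linarith
      · rw [Finset.sum_range_succ, mul_add]
        have h8 : a * γ (N + k) * δ ^ 2 ≤ a * γ (N + k) * ‖d (N + k)‖ ^ 2 := by gcongr
        linarith
  have hbound : ∀ k, ∑ i ∈ Finset.range (N + k), γ i ≤
      ∑ i ∈ Finset.range N, γ i + (V N - b) / (a * δ ^ 2) := by
    intro k
    rw [Finset.sum_range_add]
    gcongr
    rw [le_div_iff₀ (by positivity), mul_comm]
    linarith [(htrap k).2, hb (N + k)]
  obtain ⟨M, hM⟩ := (hγsum.eventually_gt_atTop
    (∑ i ∈ Finset.range N, γ i + (V N - b) / (a * δ ^ 2))).and (eventually_ge_atTop N) |>.exists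
  have := hbound (M - N)
  rw [show N + (M - N) = M by omega] at this
  linarith [hM.1]

end GhostPenalty
end

noncomputable section
namespace GhostPenalty

/-! ### The box, the infeasibility measure and multipliers -/

section Elementary

variable {n m : ℕ}

lemma isCompact_box (n : ℕ) (r : ℝ) : IsCompact (box n r) := by
  have h1 : IsCompact (Set.univ.pi fun _ : Fin n => Icc (-r) r) :=
    isCompact_univ_pi fun _ => isCompact_Icc
  have h2 := h1.image (PiLp.continuous_toLp 2 fun _ : Fin n => ℝ)
  convert h2 using 1
  ext d
  constructor
  · exact fun hd => ⟨d.ofLp, fun i _ => abs_le.1 (hd i), rfl⟩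
  · rintro ⟨y, hy, rfl⟩ i
    exact abs_le.2 (hy i trivial)

lemma convex_box (n : ℕ) (r : ℝ) : Convex ℝ (box n r) := by
  intro u hu v hv s t hs ht hst i
  have h1 := abs_le.1 (hu i)
  have h2 := abs_le.1 (hv i)
  simp only [PiLp.add_apply, PiLp.smul_apply, smul_eq_mul]
  refine abs_le.2 ⟨?_, ?_⟩ <;> nlinarith

lemma zero_mem_box {r : ℝ} (hr : 0 ≤ r) : (0 : E n) ∈ box n r := fun i => by simpa using hr

lemma box_mono {r s : ℝ} (h : r ≤ s) : box n r ⊆ box n s := fun _ hd i => (hd i).trans h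

lemma box_mem_nhds_zero {r : ℝ} (hr : 0 < r) : box n r ∈ 𝓝 (0 : E n) := by
  refine mem_of_superset (Metric.ball_mem_nhds 0 hr) fun d hd i => ?_
  rw [mem_ball_zero_iff] at hd
  exact ((PiLp.norm_apply_le d i).trans hd.le)

lemma tendsto_smul_zero_nhdsGT (h : E n) : Tendsto (fun t : ℝ => t • h) (𝓝[>] 0) (𝓝 0) := by
  have : Continuous fun t : ℝ => t • h := by fun_prop
  simpa using (this.tendsto 0).mono_left (nhdsWithin_le_nhds (s := Ioi 0))

lemma maxPos_nonneg (y : Fin m → ℝ) : 0 ≤ maxPos y := Real.iSup_nonneg fun _ => le_max_right _ _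

lemma le_maxPos (y : Fin m → ℝ) (i : Fin m) : y i ≤ maxPos y :=
  (le_max_left _ _).trans (le_ciSup (f := fun i => max (y i) 0) (finite_range _).bddAbove i)

lemma maxPos_le {y : Fin m → ℝ} {c : ℝ} (hc : 0 ≤ c) (h : ∀ i, y i ≤ c) : maxPos y ≤ c :=
  Real.iSup_le (fun i => max_le (h i) hc) hc

/-- The sup norm form yields continuity and strict bounds, with `m = 0` included. -/
lemma maxPos_eq_norm (y : Fin m → ℝ) : maxPos y = ‖fun i => max (y i) 0‖ := by
  apply le_antisymm
  · refine maxPos_le (norm_nonneg _) fun i => (le_max_left _ 0).trans ?_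
    exact (le_abs_self _).trans (norm_le_pi_norm (fun i => max (y i) 0) i)
  · rw [pi_norm_le_iff_of_nonneg (maxPos_nonneg y)]
    intro i
    rw [Real.norm_of_nonneg (le_max_right _ _)]
    exact max_le (le_maxPos y i) (maxPos_nonneg y)

lemma maxPos_lt {y : Fin m → ℝ} {c : ℝ} (hc : 0 < c) (h : ∀ i, y i < c) : maxPos y < c := by
  rw [maxPos_eq_norm, pi_norm_lt_iff hc]
  intro i
  rw [Real.norm_of_nonneg (le_max_right _ _)]
  exact max_lt (h i) hc

lemma continuous_maxPos : Continuous (maxPos : (Fin m → ℝ) → ℝ) := by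
  rw [show (maxPos : (Fin m → ℝ) → ℝ) = _ from funext maxPos_eq_norm]
  fun_prop

lemma maxPos_eq_zero {y : Fin m → ℝ} (h : y ≤ 0) : maxPos y = 0 :=
  le_antisymm (maxPos_le le_rfl h) (maxPos_nonneg y)

lemma exists_eq_maxPos {y : Fin m → ℝ} (h : 0 < maxPos y) : ∃ i, y i = maxPos y := by
  by_contra! hne
  exact (maxPos_lt h fun i => lt_of_le_of_ne (le_maxPos y i) (hne i)).false

lemma mem_normalCone_Iic {y ξ : Fin m → ℝ} (hy : y ≤ 0) (hξ : ∀ i, 0 ≤ ξ i)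
    (hc : ∀ i, y i ≠ 0 → ξ i = 0) : ξ ∈ normalCone (Iic 0) y := by
  refine ⟨hy, fun z hz => Finset.sum_nonpos fun i _ => ?_⟩
  by_cases h : y i = 0
  · simpa [h] using mul_nonpos_of_nonneg_of_nonpos (hξ i) (hz i)
  · simp [hc i h]

/-- Under the eMFCQ the maximal constraints have a common strict descent direction. -/
lemma EMFCQ.exists_descent {g : E n → Fin m → ℝ} {p : E n} (h : EMFCQ g p) :
    ∃ v : E n, ∀ i, g p i = maxPos (g p) → inner ℝ (gradient (fun y => g y i) p) v < 0 := by
  rcases gordan_alternative {i | g p i = maxPos (g p)} (fun i => gradient (fun y => g y i) p)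
    with hv | ⟨w, hw0, hw1, hw2, hw3⟩
  · exact hv
  · exfalso
    have hmem : w ∈ M0 g p := by
      refine ⟨mem_normalCone_Iic (fun i => sub_nonpos.2 (le_maxPos _ i)) hw0 fun i hi => ?_,
        hw3.symm⟩
      exact hw1 i fun h => hi (sub_eq_zero.2 h)
    rw [h, mem_singleton_iff] at hmem
    simp [hmem] at hw2

/-- At a feasible point that satisfies the eMFCQ but is not KKT, the objective and the active
constraints have a common strict descent direction. -/
lemma EMFCQ.exists_descent_of_not_isKKT {f : E n → ℝ} {g : E n → Fin m → ℝ} {p : E n}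
    (h : EMFCQ g p) (hfeas : g p ≤ 0) (hK : ¬ IsKKT f g p) :
    ∃ v : E n, inner ℝ (gradient f p) v < 0 ∧
      ∀ i, g p i = 0 → inner ℝ (gradient (fun y => g y i) p) v < 0 := by
  -- The index `none` stands for the objective and satisfies the membership condition vacuously.
  rcases gordan_alternative {o : Option (Fin m) | ∀ i ∈ o, g p i = 0}
    (fun o => o.elim (gradient f p) fun i => gradient (fun y => g y i) p)
    with ⟨v, hv⟩ | ⟨w, hw0, hw1, hw2, hw3⟩
  · exact ⟨v, hv none (by simp), fun i hi => hv (some i) (by simpa using hi)⟩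
  · exfalso
    simp only [Fintype.sum_option, Option.elim_none, Option.elim_some] at hw2 hw3
    have hsupp : ∀ i, g p i ≠ 0 → w (some i) = 0 := fun i hi => hw1 _ (by simpa using hi)
    -- With zero weight on the objective, the rest is a nonzero abnormal multiplier; with positive
    -- weight, dividing by it gives a KKT multiplier.
    rcases (hw0 none).eq_or_lt with hz | hpos
    · have hmem : (fun i => w (some i)) ∈ M0 g p := by
        refine ⟨?_, ?_⟩
        · simp only [maxPos_eq_zero hfeas, sub_zero]
          exact mem_normalCone_Iic hfeas (fun i => hw0 _) hsupp
        · rw [← hz, zero_smul, zero_add] at hw3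
          exact hw3.symm
      rw [h, mem_singleton_iff] at hmem
      have : ∀ i, w (some i) = 0 := fun i => congrFun hmem i
      simp [← hz, this] at hw2
    · refine hK ⟨hfeas, fun i => (w none)⁻¹ * w (some i), ?_, ?_⟩
      · refine mem_normalCone_Iic hfeas (fun i => ?_) fun i hi => by simp [hsupp i hi]
        exact mul_nonneg (inv_nonneg.2 hpos.le) (hw0 _)
      · have := congrArg (fun z => (w none)⁻¹ • z) hw3
        simp only [smul_add, smul_smul, inv_mul_cancel₀ hpos.ne', one_smul, Finset.smul_sum,
          smul_zero] at this
        exact this.symm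

/-- The Fritz-John and external cases together cover every point, feasible or not, with a nontrivial
abnormal multiplier. -/
lemma emfcq_of_not_isStationary {f : E n → ℝ} {g : E n → Fin m → ℝ} {p : E n}
    (h : ¬ IsStationary f g p) : EMFCQ g p := by
  by_contra hM
  by_cases hfeas : g p ≤ 0
  · exact h (Or.inr (Or.inl ⟨hfeas, hM⟩))
  · rw [Pi.le_def] at hfeas
    push Not at hfeas
    exact h (Or.inr (Or.inr ⟨hfeas, hM⟩))

lemma IsStationary.isKKT {f : E n → ℝ} {g : E n → Fin m → ℝ} {p : E n}
    (h : IsStationary f g p) (hM : EMFCQ g p) : IsKKT f g p := by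
  rcases h with h | h | h
  · exact h
  · exact absurd hM h.2
  · exact absurd hM h.2

end Elementary

/-! ### The direction-finding subproblem -/

namespace SurrogateAssumptions

variable {n m : ℕ} {f : E n → ℝ} {g : E n → Fin m → ℝ} {ft : E n → E n → ℝ}
  {gt : E n → E n → Fin m → ℝ} {β ρ lam : ℝ} {O : Set (E n)}

lemma zero_mem (hA : SurrogateAssumptions f g ft gt β O) (hβ : 0 ≤ β) : (0 : E n) ∈ O :=
  hA.box_subset (zero_mem_box hβ)

lemma continuousAt_f (hA : SurrogateAssumptions f g ft gt β O) {d : E n} (hd : d ∈ O) (x : E n) :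
    ContinuousAt (fun p : E n × E n => ft p.1 p.2) (d, x) :=
  hA.continuous_f.continuousAt ((hA.isOpen.prod isOpen_univ).mem_nhds ⟨hd, trivial⟩)

lemma continuousAt_g (hA : SurrogateAssumptions f g ft gt β O) {d : E n} (hd : d ∈ O) (x : E n)
    (i : Fin m) : ContinuousAt (fun p : E n × E n => gt p.1 p.2 i) (d, x) :=
  (hA.continuous_g i).continuousAt ((hA.isOpen.prod isOpen_univ).mem_nhds ⟨hd, trivial⟩)

lemma continuousOn_g_left (hA : SurrogateAssumptions f g ft gt β O) (x : E n) (i : Fin m) :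
    ContinuousOn (fun d => gt d x i) O := (hA.contDiff_g i x).continuousOn

lemma hasGradientAt_f (hA : SurrogateAssumptions f g ft gt β O) (hβ : 0 ≤ β) (x : E n) :
    HasGradientAt (fun d => ft d x) (gradient f x) 0 := by
  rw [← hA.grad_f_zero x]
  exact (((hA.contDiff_f x).differentiableOn (by norm_num)).differentiableAt
    (hA.isOpen.mem_nhds (hA.zero_mem hβ))).hasGradientAt

lemma hasGradientAt_g (hA : SurrogateAssumptions f g ft gt β O) (hβ : 0 ≤ β) (x : E n)
    (i : Fin m) : HasGradientAt (fun d => gt d x i) (gradient (fun y => g y i) x) 0 := by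
  rw [← hA.grad_g_zero i x]
  exact (((hA.contDiff_g i x).differentiableOn (by norm_num)).differentiableAt
    (hA.isOpen.mem_nhds (hA.zero_mem hβ))).hasGradientAt

lemma gt_zero (hA : SurrogateAssumptions f g ft gt β O) (x : E n) : gt 0 x = g x :=
  funext fun i => hA.g_zero i x

lemma bddBelow_image (gt : E n → E n → Fin m → ℝ) (ρ : ℝ) (x : E n) :
    BddBelow ((fun d => maxPos (gt d x)) '' box n ρ) :=
  ⟨0, by rintro _ ⟨d, _, rfl⟩; exact maxPos_nonneg _⟩

lemma continuous_g_base (hA : SurrogateAssumptions f g ft gt β O) (hβ : 0 ≤ β) :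
    Continuous g := by
  refine continuous_pi fun i => continuous_iff_continuousAt.2 fun x => ?_
  have h : ContinuousAt (fun y : E n => ((0 : E n), y)) x := by fun_prop
  have h2 : ContinuousAt (fun y => gt 0 y i) x :=
    (hA.continuousAt_g (hA.zero_mem hβ) x i).comp' (f := fun y : E n => ((0 : E n), y)) h
  simpa only [hA.gt_zero] using h2

lemma continuous_kappa (hA : SurrogateAssumptions f g ft gt β O) (hρ : 0 ≤ ρ) (hρβ : ρ ≤ β) :
    Continuous (kappa g gt ρ lam) := by
  have h1 : Continuous fun x => sInf ((fun d => maxPos (gt d x)) '' box n ρ) := by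
    have : CompactSpace (box n ρ) := isCompact_iff_compactSpace.1 (isCompact_box n ρ)
    have h := (isCompact_univ (X := box n ρ)).continuous_sInf
      (f := fun (x : E n) (d : box n ρ) => maxPos (gt d x)) (by
        refine continuous_maxPos.comp (continuous_pi fun i => ?_)
        exact (hA.continuous_g i).comp_continuous
          (f := fun q : E n × box n ρ => ((q.2 : E n), q.1)) (by fun_prop)
          fun q => ⟨hA.box_subset (box_mono hρβ q.2.2), trivial⟩)
    exact h.congr fun x => by rw [image_univ, image_eq_range]
  have h2 := continuous_maxPos.comp (hA.continuous_g_base (hρ.trans hρβ))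
  exact (h2.const_mul _).add (h1.const_mul _)

lemma exists_argmin (hA : SurrogateAssumptions f g ft gt β O) (hρ : 0 ≤ ρ) (hρβ : ρ ≤ β)
    (x : E n) : ∃ d ∈ box n ρ, ∀ u ∈ box n ρ, maxPos (gt d x) ≤ maxPos (gt u x) :=
  (isCompact_box n ρ).exists_isMinOn ⟨0, zero_mem_box hρ⟩
    (continuous_maxPos.comp_continuousOn (continuousOn_pi.2 fun i =>
      (hA.continuousOn_g_left x i).mono ((box_mono hρβ).trans hA.box_subset)))

lemma sInf_le_maxPos (hA : SurrogateAssumptions f g ft gt β O) (hρ : 0 ≤ ρ) (x : E n) :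
    sInf ((fun d => maxPos (gt d x)) '' box n ρ) ≤ maxPos (g x) := by
  have := csInf_le (bddBelow_image gt ρ x) (mem_image_of_mem _ (zero_mem_box hρ))
  simpa only [hA.gt_zero] using this

lemma kappa_nonneg (hρ : 0 ≤ ρ) (h0 : 0 ≤ lam) (h1 : lam ≤ 1) (x : E n) :
    0 ≤ kappa g gt ρ lam x := by
  have h2 : 0 ≤ sInf ((fun d => maxPos (gt d x)) '' box n ρ) :=
    le_csInf ⟨_, mem_image_of_mem _ (zero_mem_box hρ)⟩
      (by rintro _ ⟨d, _, rfl⟩; exact maxPos_nonneg _)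
  have h3 := maxPos_nonneg (g x)
  have : 0 ≤ 1 - lam := sub_nonneg.2 h1
  unfold kappa; positivity

lemma kappa_le_maxPos (hA : SurrogateAssumptions f g ft gt β O) (hρ : 0 ≤ ρ) (h0 : 0 ≤ lam)
    (x : E n) : kappa g gt ρ lam x ≤ maxPos (g x) := by
  have := mul_le_mul_of_nonneg_left (hA.sInf_le_maxPos hρ x) h0
  unfold kappa; linarith

/-- A minimizer of the surrogate infeasibility over the `ρ`-box is feasible, as `kappa` averages
that minimum with the larger `maxPos (g x)`. -/
lemma exists_mem_feasibleSet (hA : SurrogateAssumptions f g ft gt β O) (hρ : 0 ≤ ρ)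
    (hρβ : ρ ≤ β) (h1 : lam ≤ 1) (x : E n) : (feasibleSet g gt β ρ lam x).Nonempty := by
  obtain ⟨d, hd, hmin⟩ := hA.exists_argmin hρ hρβ x
  refine ⟨d, fun i => (le_maxPos _ i).trans ?_, box_mono hρβ hd⟩
  have h2 : maxPos (gt d x) ≤ sInf ((fun d => maxPos (gt d x)) '' box n ρ) :=
    le_csInf ⟨_, mem_image_of_mem _ hd⟩ (by rintro _ ⟨u, hu, rfl⟩; exact hmin u hu)
  have h3 := hA.sInf_le_maxPos hρ x
  have h4 := mul_le_mul_of_nonneg_left h3 (sub_nonneg.2 h1)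
  unfold kappa; linarith

lemma isSubproblemSolution_direction (hA : SurrogateAssumptions f g ft gt β O) (hρ : 0 ≤ ρ)
    (hρβ : ρ ≤ β) (h1 : lam ≤ 1) (x : E n) :
    IsSubproblemSolution g ft gt β ρ lam x (direction g ft gt β ρ lam x) := by
  apply Classical.epsilon_spec
  have hcl : IsClosed (feasibleSet g gt β ρ lam x) := by
    have : feasibleSet g gt β ρ lam x = box n β ∩ ⋂ i, (box n β ∩
        (fun d => gt d x i) ⁻¹' Iic (kappa g gt ρ lam x)) := by
      ext d
      simp only [feasibleSet, mem_ofPred_eq, mem_inter_iff, mem_iInter, mem_preimage, mem_Iic]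
      exact ⟨fun h => ⟨h.2, fun i => ⟨h.2, h.1 i⟩⟩, fun h => ⟨fun i => (h.2 i).2, h.1⟩⟩
    rw [this]
    refine (isCompact_box n β).isClosed.inter (isClosed_iInter fun i => ?_)
    exact ((hA.continuousOn_g_left x i).mono hA.box_subset).preimage_isClosed_of_isClosed
      (isCompact_box n β).isClosed isClosed_Iic
  have hK : IsCompact (feasibleSet g gt β ρ lam x) :=
    (isCompact_box n β).of_isClosed_subset hcl fun d hd => hd.2
  obtain ⟨d, hd, hmin⟩ := hK.exists_isMinOn (hA.exists_mem_feasibleSet hρ hρβ h1 x)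
    ((hA.contDiff_f x).continuousOn.mono fun d hd => hA.box_subset hd.2)
  exact ⟨d, hd, hmin⟩

/-- Strict decrease of all surrogate constraints below the infeasibility level, along small
multiples of a descent direction for the maximal ones. -/
lemma eventually_gt_lt_maxPos (hA : SurrogateAssumptions f g ft gt β O) (hβ : 0 ≤ β) {p v : E n}
    (hv : ∀ i, g p i = maxPos (g p) → inner ℝ (gradient (fun y => g y i) p) v < 0) :
    ∀ᶠ t : ℝ in 𝓝[>] 0, ∀ i, gt (t • v) p i < maxPos (g p) := by
  refine eventually_all.2 fun i => ?_
  by_cases hi : g p i = maxPos (g p)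
  · have := eventually_lt_of_inner_neg (hA.hasGradientAt_g hβ p i) (hv i hi)
    simpa only [hA.g_zero, hi] using this
  · have hlt : gt 0 p i < maxPos (g p) := by
      rw [hA.g_zero]; exact lt_of_le_of_ne (le_maxPos _ i) hi
    have hc : ContinuousAt (fun d => gt d p i) 0 :=
      (hA.hasGradientAt_g hβ p i).hasFDerivAt.continuousAt
    exact (hc.tendsto.comp (tendsto_smul_zero_nhdsGT v)).eventually_lt_const hlt

/-- A short enough step along an eMFCQ descent direction stays in the `ρ`-box and lowers every
surrogate below the infeasibility level. -/
lemma sInf_lt_maxPos (hA : SurrogateAssumptions f g ft gt β O) (hρ : 0 < ρ) (hβ : 0 ≤ β)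
    {p : E n} (hM : EMFCQ g p) (hp : 0 < maxPos (g p)) :
    sInf ((fun d => maxPos (gt d p)) '' box n ρ) < maxPos (g p) := by
  obtain ⟨v, hv⟩ := hM.exists_descent
  obtain ⟨t, ht1, ht2⟩ := ((hA.eventually_gt_lt_maxPos hβ hv).and
    ((tendsto_smul_zero_nhdsGT v).eventually (box_mem_nhds_zero hρ))).exists
  exact (csInf_le (bddBelow_image gt ρ p) (mem_image_of_mem _ ht2)).trans_lt (maxPos_lt hp ht1)

lemma kappa_lt_maxPos (hA : SurrogateAssumptions f g ft gt β O) (hρ : 0 < ρ) (hβ : 0 ≤ β)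
    (h0 : 0 < lam) {p : E n} (hM : EMFCQ g p) (hp : 0 < maxPos (g p)) :
    kappa g gt ρ lam p < maxPos (g p) := by
  have := mul_lt_mul_of_pos_left (hA.sInf_lt_maxPos hρ hβ hM hp) h0
  unfold kappa; linarith

/-- Under the eMFCQ the subproblem has a Slater point. -/
lemma exists_slater (hA : SurrogateAssumptions f g ft gt β O) (hρ : 0 < ρ) (hρβ : ρ ≤ β)
    (h0 : 0 ≤ lam) (h1 : lam < 1) {p : E n} (hM : EMFCQ g p) :
    ∃ v ∈ box n β, ∀ i, gt v p i < kappa g gt ρ lam p := by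
  have hβ := hρ.le.trans hρβ
  -- At a feasible point a short descent step makes all surrogates negative. At an infeasible one
  -- the minimizer over the `ρ`-box works, since `lam < 1` puts `kappa` strictly above the minimum.
  rcases (maxPos_nonneg (g p)).eq_or_lt with hz | hpos
  · obtain ⟨v, hv⟩ := hM.exists_descent
    obtain ⟨t, ht1, ht2⟩ := ((hA.eventually_gt_lt_maxPos hβ hv).and
      ((tendsto_smul_zero_nhdsGT v).eventually (box_mem_nhds_zero hρ))).exists
    refine ⟨t • v, box_mono hρβ ht2, fun i => (ht1 i).trans_le ?_⟩
    rw [← hz]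
    exact kappa_nonneg hρ.le h0 h1.le p
  · obtain ⟨d, hd, hmin⟩ := hA.exists_argmin hρ.le hρβ p
    refine ⟨d, box_mono hρβ hd, fun i => (le_maxPos _ i).trans_lt ?_⟩
    have h2 : maxPos (gt d p) ≤ sInf ((fun d => maxPos (gt d p)) '' box n ρ) :=
      le_csInf ⟨_, mem_image_of_mem _ hd⟩ (by rintro _ ⟨u, hu, rfl⟩; exact hmin u hu)
    have h3 := mul_lt_mul_of_pos_left (hA.sInf_lt_maxPos hρ hβ hM hpos) (sub_pos.2 h1)
    unfold kappa; linarith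

/-- Near a point satisfying the eMFCQ, the slope of the objective along the subproblem solution is
controlled by the decrease of the infeasibility. -/
lemma exists_eventually_inner_direction_le (hA : SurrogateAssumptions f g ft gt β O) (hρ : 0 < ρ)
    (hρβ : ρ ≤ β) (h0 : 0 ≤ lam) (h1 : lam < 1) {c : ℝ} (hc0 : 0 ≤ c)
    (hc : ∀ x, StrongConvexOn O c (fun d => ft d x)) {p : E n} (hM : EMFCQ g p) :
    ∃ C, ∀ᶠ x in 𝓝 p, inner ℝ (gradient f x) (direction g ft gt β ρ lam x) ≤
      C * (maxPos (g x) - kappa g gt ρ lam x) - c / 2 * ‖direction g ft gt β ρ lam x‖ ^ 2 := by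
  have hβ := hρ.le.trans hρβ
  obtain ⟨v, hvb, hv⟩ := hA.exists_slater hρ hρβ h0 h1 hM
  have hvO := hA.box_subset hvb
  have hpair : ∀ u : E n, ContinuousAt (fun y : E n => (u, y)) p := fun u => by fun_prop
  have hgv : ∀ i, ContinuousAt (fun x => gt v x i) p := fun i =>
    (hA.continuousAt_g hvO p i).comp' (f := fun y : E n => (v, y)) (hpair v)
  have hfc : ∀ u ∈ O, ContinuousAt (fun x => ft u x) p := fun u hu =>
    (hA.continuousAt_f hu p).comp' (f := fun y : E n => (u, y)) (hpair u)
  have hκ := (hA.continuous_kappa (lam := lam) hρ.le hρβ).continuousAt (x := p)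
  obtain ⟨s, hs, hsv⟩ : ∃ s > 0, ∀ i, gt v p i < kappa g gt ρ lam p - s := by
    have h : ∀ᶠ s : ℝ in 𝓝[>] 0, ∀ i, gt v p i < kappa g gt ρ lam p - s := by
      refine eventually_all.2 fun i => nhdsWithin_le_nhds ?_
      have hct : Continuous fun s : ℝ => kappa g gt ρ lam p - s := by fun_prop
      exact (hct.tendsto 0).eventually_const_lt (by simpa using hv i)
    obtain ⟨s, h2, h3⟩ := (h.and self_mem_nhdsWithin).exists
    exact ⟨s, h3, h2⟩
  have ev1 : ∀ᶠ x in 𝓝 p, ∀ i, gt v x i < kappa g gt ρ lam x - s :=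
    eventually_all.2 fun i => (hgv i).eventually_lt (hκ.sub continuousAt_const) (hsv i)
  have ev2 : ∀ᶠ x in 𝓝 p, ft v x - ft 0 x < |ft v p - ft 0 p| + 1 :=
    ((hfc v hvO).sub (hfc 0 (hA.zero_mem hβ))).eventually_lt continuousAt_const
      (lt_of_le_of_lt (le_abs_self (ft v p - ft 0 p)) (lt_add_one _))
  set B := |ft v p - ft 0 p| + 1 with hB
  have hB0 : 0 < B := by positivity
  refine ⟨B / s, ?_⟩
  filter_upwards [ev1, ev2] with x hx1 hx2
  set d := direction g ft gt β ρ lam x with hd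
  obtain ⟨⟨hd1, hd2⟩, hdmin⟩ := hA.isSubproblemSolution_direction (lam := lam) hρ.le hρβ h1.le x
  set θ := maxPos (g x) - kappa g gt ρ lam x with hθ
  have hθ0 : 0 ≤ θ := sub_nonneg.2 (hA.kappa_le_maxPos hρ.le h0 x)
  have hslope := strongConvexOn_gradient_le (hc x) (hA.hasGradientAt_f hβ x) (hA.zero_mem hβ)
    (hA.box_subset hd2)
  rw [sub_zero] at hslope
  have hθs : 0 < θ + s := by positivity
  -- At 0 the constraints exceed κ by at most θ, at `v` they lie below κ by at least `s`; this
  -- weight balances the two, so the combination is feasible. The objective then rises by at most `t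
  -- * B ≤ B / s * θ`.
  set t := θ / (θ + s) with ht
  have ht0 : 0 ≤ t := by positivity
  have ht1 : t ≤ 1 := (div_le_one hθs).2 (by linarith)
  have hts : t * (θ + s) = θ := div_mul_cancel₀ _ hθs.ne'
  have hwfeas : (1 - t) • (0 : E n) + t • v ∈ feasibleSet g gt β ρ lam x := by
    refine ⟨fun i => ?_, convex_box n β (zero_mem_box hβ) hvb (sub_nonneg.2 ht1) ht0 (by ring)⟩
    have h2 := (hA.convex_g i x).2 (hA.zero_mem hβ) hvO (sub_nonneg.2 ht1) ht0 (by ring)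
    simp only [hA.g_zero, smul_eq_mul] at h2
    refine h2.trans ?_
    have h3 := mul_le_mul_of_nonneg_left (le_maxPos (g x) i) (sub_nonneg.2 ht1)
    have h4 := mul_le_mul_of_nonneg_left (hx1 i).le ht0
    have h5 : maxPos (g x) = θ + kappa g gt ρ lam x := by rw [hθ]; ring
    rw [h5] at h3
    nlinarith
  have h2 : ft d x ≤ ft ((1 - t) • (0 : E n) + t • v) x := hdmin hwfeas
  have h3 := (strongConvexOn_zero.1 ((hc x).mono hc0)).2 (hA.zero_mem hβ) hvO
    (sub_nonneg.2 ht1) ht0 (by ring)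
  simp only [smul_eq_mul] at h3
  have h4 : t * (ft v x - ft 0 x) ≤ t * B := mul_le_mul_of_nonneg_left hx2.le ht0
  have h5 : t * B ≤ B / s * θ := by
    rw [ht, div_mul_eq_mul_div, div_mul_eq_mul_div, mul_comm θ B]
    gcongr
    linarith
  linarith

/-- The subproblem solutions stay away from zero near a point that satisfies the eMFCQ but is not
KKT. -/
lemma exists_eventually_le_norm_direction (hA : SurrogateAssumptions f g ft gt β O) (hρ : 0 < ρ)
    (hρβ : ρ ≤ β) (h0 : 0 < lam) (h1 : lam ≤ 1) {p : E n} (hM : EMFCQ g p)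
    (hK : ¬ IsKKT f g p) :
    ∃ δ > 0, ∀ᶠ x in 𝓝 p, δ ≤ ‖direction g ft gt β ρ lam x‖ := by
  have hβ := hρ.le.trans hρβ
  have hO := hA.zero_mem hβ
  have hκ := hA.continuous_kappa (lam := lam) hρ.le hρβ
  have hκ2 : ContinuousAt (fun q : E n × E n => kappa g gt ρ lam q.2) (0, p) :=
    (hκ.comp continuous_snd).continuousAt
  -- It is enough that no direction near 0 solves the subproblem at a base point near `p`.
  suffices h : ∀ᶠ q : E n × E n in 𝓝 (0, p), q.1 ≠ direction g ft gt β ρ lam q.2 by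
    rw [nhds_prod_eq] at h
    obtain ⟨P, hP, R, hR, hPR⟩ := eventually_prod_iff.1 h
    obtain ⟨δ, hδ, hball⟩ := Metric.eventually_nhds_iff.1 hP
    refine ⟨δ, hδ, hR.mono fun x hx => ?_⟩
    by_contra! hlt
    exact hPR (hball (by simpa using hlt)) hx rfl
  rcases (maxPos_nonneg (g p)).eq_or_lt with hz | hpos
  -- Feasible `p`: a fixed short step `u` is strictly feasible and beats every direction near 0,
  -- also for nearby base points.
  · have hfeas : g p ≤ 0 := fun i => (le_maxPos _ i).trans_eq hz.symm
    obtain ⟨v, hvf, hvg⟩ := hM.exists_descent_of_not_isKKT hfeas hK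
    obtain ⟨t, ⟨ht1, ht2⟩, ht3⟩ := ((hA.eventually_gt_lt_maxPos hβ
      (fun i hi => hvg i (hi.trans hz.symm))).and
      ((tendsto_smul_zero_nhdsGT v).eventually (box_mem_nhds_zero (hρ.trans_le hρβ)))).and
      (eventually_lt_of_inner_neg (hA.hasGradientAt_f hβ p) hvf) |>.exists
    set u := t • v
    have huO := hA.box_subset ht2
    have hpair : ContinuousAt (fun q : E n × E n => (u, q.2)) (0, p) := by fun_prop
    have e1 : ∀ᶠ q : E n × E n in 𝓝 (0, p), ∀ i, gt u q.2 i < kappa g gt ρ lam q.2 := by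
      refine eventually_all.2 fun i => ?_
      refine ContinuousAt.eventually_lt
        ((hA.continuousAt_g huO p i).comp' (f := fun q : E n × E n => (u, q.2)) hpair) hκ2 ?_
      refine (ht1 i).trans_le ?_
      rw [← hz]
      exact kappa_nonneg hρ.le h0.le h1 p
    have e2 : ∀ᶠ q : E n × E n in 𝓝 (0, p), ft u q.2 < ft q.1 q.2 :=
      ContinuousAt.eventually_lt
        ((hA.continuousAt_f huO p).comp' (f := fun q : E n × E n => (u, q.2)) hpair)
        (hA.continuousAt_f hO p) ht3
    filter_upwards [e1, e2] with q hq1 hq2 heq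
    obtain ⟨-, hmin⟩ := hA.isSubproblemSolution_direction (lam := lam) hρ.le hρβ h1 q.2
    have h2 : ft (direction g ft gt β ρ lam q.2) q.2 ≤ ft u q.2 :=
      hmin ⟨fun i => (hq1 i).le, ht2⟩
    rw [← heq] at h2
    linarith
  -- Infeasible `p`: since κ(p) < maxPos (g p), directions near 0 violate the relaxed constraint
  -- `i`.
  · obtain ⟨i, hi⟩ := exists_eq_maxPos hpos
    have e : ∀ᶠ q : E n × E n in 𝓝 (0, p), kappa g gt ρ lam q.2 < gt q.1 q.2 i := by
      refine hκ2.eventually_lt (hA.continuousAt_g hO p i) ?_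
      simp only [hA.g_zero, hi]
      exact hA.kappa_lt_maxPos hρ hβ h0 hM hpos
    filter_upwards [e] with q hq heq
    have h2 := (hA.isSubproblemSolution_direction (lam := lam) hρ.le hρβ h1 q.2).1.1 i
    rw [← heq] at h2
    linarith

end SurrogateAssumptions

end GhostPenalty
end

/-! ### Descent of the penalty function and convergence -/

noncomputable section
namespace GhostPenalty

variable {n m : ℕ} {f : E n → ℝ} {g : E n → Fin m → ℝ} {ft : E n → E n → ℝ}
  {gt : E n → E n → Fin m → ℝ} {β ρ lam : ℝ} {O : Set (E n)}

/-- Along steps of the method the infeasibility satisfies a descent inequality. -/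
lemma SurrogateAssumptions.maxPos_step_le (hA : SurrogateAssumptions f g ft gt β O) (hρ : 0 ≤ ρ)
    (hρβ : ρ ≤ β) (h0 : 0 ≤ lam) (h1 : lam ≤ 1) {L γ : ℝ} (hL : 0 ≤ L) (hγ0 : 0 ≤ γ)
    (hγ1 : γ ≤ 1) {x d : E n} (hd : d = direction g ft gt β ρ lam x)
    (hq : ∀ i, g (x + γ • d) i ≤
      g x i + inner ℝ (gradient (fun y => g y i) x) (γ • d) + L * ‖γ • d‖ ^ 2) :
    maxPos (g (x + γ • d)) ≤
      maxPos (g x) - γ * (maxPos (g x) - kappa g gt ρ lam x) + L * (γ ^ 2 * ‖d‖ ^ 2) := by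
  have hβ := hρ.trans hρβ
  have hκ : 0 ≤ kappa g gt ρ lam x := kappa_nonneg hρ h0 h1 x
  have hφ := mul_nonneg (sub_nonneg.2 hγ1) (maxPos_nonneg (g x))
  refine maxPos_le ?_ fun i => (hq i).trans ?_
  · have h2 : 0 ≤ L * (γ ^ 2 * ‖d‖ ^ 2) := by positivity
    have h3 := mul_nonneg hγ0 hκ
    linarith
  -- Convexity bounds the slope of `g i` along `d` by `κ - g i`, so the linearization is at most `(1
  -- - γ) * g i + γ * κ`; `γ ≤ 1` allows `g i` to be replaced by `maxPos`.
  · obtain ⟨⟨hd1, hd2⟩, -⟩ := hA.isSubproblemSolution_direction (lam := lam) hρ hρβ h1 x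
    rw [← hd] at hd1 hd2
    have h2 := strongConvexOn_gradient_le (strongConvexOn_zero.2 (hA.convex_g i x))
      (hA.hasGradientAt_g hβ x i) (hA.zero_mem hβ) (hA.box_subset hd2)
    simp only [sub_zero, hA.g_zero, zero_div, zero_mul] at h2
    have h3 := mul_le_mul_of_nonneg_left (h2.trans (sub_le_sub_right (hd1 i) _)) hγ0
    have h4 := mul_le_mul_of_nonneg_left (le_maxPos (g x) i) (sub_nonneg.2 hγ1)
    rw [real_inner_smul_right, norm_smul, mul_pow, Real.norm_eq_abs, sq_abs]
    linarith

/-- If the eMFCQ holds at every limit point of a bounded sequence of iterates, then every limit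
point is a KKT point. -/
lemma SurrogateAssumptions.isKKT_of_isLimitPoint (hA : SurrogateAssumptions f g ft gt β O)
    (hf : IsLC1 f) (hg : ∀ i, IsLC1 (fun y => g y i)) (hρ : 0 < ρ) (hρβ : ρ ≤ β)
    (h0 : 0 < lam) (h1 : lam < 1) {γ : ℕ → ℝ} (hγpos : ∀ ν, 0 < γ ν)
    (hγlim : Tendsto γ atTop (𝓝 0))
    (hγsum : Tendsto (fun N => ∑ ν ∈ Finset.range N, γ ν) atTop atTop) {x : ℕ → E n}
    (hstep : ∀ ν, x (ν + 1) = x ν + γ ν • direction g ft gt β ρ lam (x ν))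
    (hbdd : Bornology.IsBounded (range x)) (hM : ∀ p, IsLimitPoint x p → EMFCQ g p) {p : E n}
    (hp : IsLimitPoint x p) : IsKKT f g p := by
  by_contra hK
  obtain ⟨δ, hδ, hev⟩ := hA.exists_eventually_le_norm_direction hρ hρβ h0 h1.le (hM p hp) hK
  obtain ⟨r, hr, hball⟩ := Metric.eventually_nhds_iff.1 hev
  obtain ⟨c, hc0, hc⟩ := hA.strongConvex_f
  set d : ℕ → E n := fun ν => direction g ft gt β ρ lam (x ν) with hd
  obtain ⟨C, hC⟩ := exists_eventually_uniform hbdd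
    (Q := fun C y => inner ℝ (gradient f y) (direction g ft gt β ρ lam y) ≤
      C * (maxPos (g y) - kappa g gt ρ lam y) - c / 2 * ‖direction g ft gt β ρ lam y‖ ^ 2)
    (fun a b y hab h => h.trans (sub_le_sub_right (mul_le_mul_of_nonneg_right hab
      (sub_nonneg.2 (hA.kappa_le_maxPos hρ.le h0.le y))) _))
    fun q hq => hA.exists_eventually_inner_direction_le hρ hρβ h0.le h1 hc0.le hc (hM q hq)
  obtain ⟨R, hR⟩ := hbdd.subset_closedBall 0
  have hxR : ∀ ν, x ν ∈ Metric.closedBall (0 : E n) R := fun ν => hR (mem_range_self ν)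
  have hBc := isCompact_closedBall (0 : E n) R
  have hBv := convex_closedBall (0 : E n) R
  obtain ⟨Lf, hLf0, hLf⟩ := hf.exists_quadratic_bound hBc hBv
  choose L hL0 hL using fun i => (hg i).exists_quadratic_bound hBc hBv
  have hLsum : ∀ i, L i ≤ ∑ j, L j := fun i =>
    Finset.single_le_sum (fun j _ => hL0 j) (Finset.mem_univ i)
  set Lg := ∑ j, L j with hLg
  have hLg0 : 0 ≤ Lg := Finset.sum_nonneg fun j _ => hL0 j
  -- The penalty weight: `D ≥ C` cancels the term `C * θ` against the decrease of infeasibility, and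
  -- `D ≥ 0` keeps `V` bounded below.
  set D := max C 0 with hD
  have hD0 : 0 ≤ D := le_max_right _ _
  obtain ⟨b, hb⟩ := hBc.bddBelow_image hf.1.continuous.continuousOn
  -- The second-order errors consume at most half of the `c / 2` gained from strong convexity,
  -- leaving `c / 4`.
  have hsmall : ∀ᶠ ν in atTop, (Lf + D * Lg) * γ ν < c / 4 := by
    have := hγlim.const_mul (Lf + D * Lg)
    rw [mul_zero] at this
    exact this.eventually_lt_const (by positivity)
  have hdesc : ∀ᶠ ν in atTop, f (x (ν + 1)) + D * maxPos (g (x (ν + 1))) ≤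
      f (x ν) + D * maxPos (g (x ν)) - c / 4 * γ ν * ‖d ν‖ ^ 2 := by
    filter_upwards [hC, hsmall, hγlim.eventually_lt_const zero_lt_one] with ν h2 h3 h4
    have hγν := hγpos ν
    have hx1 : x (ν + 1) = x ν + γ ν • d ν := hstep ν
    have hsub : x (ν + 1) - x ν = γ ν • d ν := by rw [hx1]; abel
    have h5 := hLf _ (hxR ν) _ (hxR (ν + 1))
    rw [hsub, real_inner_smul_right, norm_smul, mul_pow, Real.norm_eq_abs, sq_abs] at h5
    have h6 := hA.maxPos_step_le (d := d ν) hρ.le hρβ h0.le h1.le hLg0 hγν.le h4.le rfl fun i => by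
      have h7 := hL i _ (hxR ν) _ (hxR (ν + 1))
      rw [hsub] at h7
      rw [hx1] at h7
      refine h7.trans ?_
      gcongr
      exact hLsum i
    rw [← hx1] at h6
    change inner ℝ (gradient f (x ν)) (d ν) ≤ C * _ - c / 2 * ‖d ν‖ ^ 2 at h2
    set θ := maxPos (g (x ν)) - kappa g gt ρ lam (x ν)
    have hθ : 0 ≤ θ := sub_nonneg.2 (hA.kappa_le_maxPos hρ.le h0.le (x ν))
    have h8 : C * θ ≤ D * θ := mul_le_mul_of_nonneg_right (le_max_left _ _) hθ
    have h9 : γ ν * inner ℝ (gradient f (x ν)) (d ν) ≤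
        γ ν * (D * θ - c / 2 * ‖d ν‖ ^ 2) := by gcongr; linarith
    have h10 := mul_le_mul_of_nonneg_left h6 hD0
    have h11 : (Lf + D * Lg) * γ ν * (γ ν * ‖d ν‖ ^ 2) ≤ c / 4 * (γ ν * ‖d ν‖ ^ 2) := by gcongr
    linarith
  refine not_limitPoint_of_descent (d := d) (a := c / 4) (b := b) hγpos hγsum hstep
    (by positivity) (V := fun ν => f (x ν) + D * maxPos (g (x ν))) hdesc (fun ν => ?_) hδ hr
    (fun ν hν => hball (by rwa [dist_eq_norm])) hp
  have h2 := hb (mem_image_of_mem f (hxR ν))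
  have h3 := mul_nonneg hD0 (maxPos_nonneg (g (x ν)))
  linarith

/-- A run that reaches a stationary point stays there. -/
lemma IsRun.eq_of_isStationary {γ : ℕ → ℝ} {x : ℕ → E n} (hx : IsRun f g ft gt β ρ lam γ x)
    {N : ℕ} (hN : IsStationary f g (x N)) (k : ℕ) : x (N + k) = x N := by
  induction k with
  | zero => rfl
  | succ k ih => rw [← add_assoc, (hx (N + k)).1 (ih ▸ hN), ih]

lemma isLimitPoint_iff_of_eventually_const {x : ℕ → E n} {N : ℕ} (h : ∀ k, x (N + k) = x N)
    {p : E n} : IsLimitPoint x p ↔ p = x N := by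
  have hlim : Tendsto x atTop (𝓝 (x N)) := by
    refine tendsto_const_nhds.congr' ?_
    filter_upwards [eventually_ge_atTop N] with k hk
    rw [← h (k - N), Nat.add_sub_cancel' hk]
  constructor
  · rintro ⟨φ, hφ, hp⟩
    exact tendsto_nhds_unique hp (hlim.comp hφ.tendsto_atTop)
  · rintro rfl
    exact ⟨id, strictMono_id, hlim⟩

end GhostPenalty
end

theorem theorem1 (n m : ℕ)
    (f : GhostPenalty.E n → ℝ) (g : GhostPenalty.E n → Fin m → ℝ)
    (hf : GhostPenalty.IsLC1 f) (hg : ∀ i, GhostPenalty.IsLC1 (fun y => g y i))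
    (ft : GhostPenalty.E n → GhostPenalty.E n → ℝ)
    (gt : GhostPenalty.E n → GhostPenalty.E n → Fin m → ℝ)
    (β ρ lam : ℝ) (hρ : 0 < ρ) (hρβ : ρ < β) (hlam0 : 0 < lam) (hlam1 : lam < 1)
    (O : Set (GhostPenalty.E n))
    (hA : GhostPenalty.SurrogateAssumptions f g ft gt β O)
    (γ : ℕ → ℝ) (hγpos : ∀ ν, 0 < γ ν) (hγlim : Tendsto γ atTop (𝓝 0))
    (hγsum : Tendsto (fun N => ∑ ν ∈ Finset.range N, γ ν) atTop atTop)
    (x : ℕ → GhostPenalty.E n)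
    (hx : GhostPenalty.IsRun f g ft gt β ρ lam γ x) :
    ¬ Bornology.IsBounded (Set.range x) ∨
      ((∃ p, GhostPenalty.IsLimitPoint x p ∧ GhostPenalty.IsStationary f g p ∧
          (GhostPenalty.EMFCQ g p → GhostPenalty.IsKKT f g p)) ∧
        ((∀ p, GhostPenalty.IsLimitPoint x p → GhostPenalty.EMFCQ g p) →
          GhostPenalty.HolderOnCompacts (GhostPenalty.direction g ft gt β ρ lam) →
          ∀ p, GhostPenalty.IsLimitPoint x p → GhostPenalty.IsKKT f g p)) := by
  by_cases hbdd : Bornology.IsBounded (Set.range x)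
  swap
  · exact Or.inl hbdd
  right
  by_cases hstat : ∃ N, GhostPenalty.IsStationary f g (x N)
  · obtain ⟨N, hN⟩ := hstat
    have hconst := hx.eq_of_isStationary hN
    refine ⟨⟨x N, (GhostPenalty.isLimitPoint_iff_of_eventually_const hconst).2 rfl, hN,
      hN.isKKT⟩, fun hM _ p hp => ?_⟩
    have hMp := hM p hp
    rw [GhostPenalty.isLimitPoint_iff_of_eventually_const hconst] at hp
    subst hp
    exact hN.isKKT hMp
  · push Not at hstat
    have hKKT : (∀ p, GhostPenalty.IsLimitPoint x p → GhostPenalty.EMFCQ g p) →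
        ∀ p, GhostPenalty.IsLimitPoint x p → GhostPenalty.IsKKT f g p := fun hM p hp =>
      hA.isKKT_of_isLimitPoint hf hg hρ hρβ.le hlam0 hlam1 hγpos hγlim hγsum
        (fun ν => (hx ν).2 (hstat ν)) hbdd hM hp
    refine ⟨?_, fun hM _ => hKKT hM⟩
    obtain ⟨p₀, -, φ, hφ, hp₀⟩ := tendsto_subseq_of_bounded hbdd fun ν => Set.mem_range_self ν
    -- A stationary limit point would satisfy (i) outright, so now no limit point is stationary and
    -- the eMFCQ holds at all of them.
    by_contra! hno
    have hns : ∀ p, GhostPenalty.IsLimitPoint x p → ¬ GhostPenalty.IsStationary f g p :=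
      fun p hp hs => by
        obtain ⟨hM, hK⟩ := hno p hp hs
        exact hK (hs.isKKT hM)
    have hlp : GhostPenalty.IsLimitPoint x p₀ := ⟨φ, hφ, hp₀⟩
    exact hns p₀ hlp (Or.inl (hKKT
      (fun p hp => GhostPenalty.emfcq_of_not_isStationary (hns p hp)) p₀ hlp))
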